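/- Let $k$ be an algebraically closed field and let $R=k[x,y,z,w]$ be bigraded so that $x,y$ have degree $(1,0)$ and $z,w$ have degree $(0,1)$; write $R_{m,n}$ for the piece of degree $(m,n)$. Let $p_0,p_1,p_2\in R_{2,1}$ have no common zero on $\mathbb{P}^1\times\mathbb{P}^1$. For $m,n\in\mathbb{Z}$ let $H^1(m,n)=H^1(\mathbb{P}^1\times\mathbb{P}^1,\mathcal{O}(m,n))$, which is the Čech cohomology of the cover by the four affine open sets $\{x\ne0,z\ne0\}$, $\{y\ne0,z\ne0\}$, $\{x\ne0,w\ne0\}$, $\{y\ne0,w\ne0\}$. Let $${}''E_2^{0,1}(m,n)=\ker\bigl(d_1\colon H^1(m-6,n-3)\to H^1(m-4,n-2)^3\bigr),$$ where $d_1$ is induced by the first map $(p_2,-p_1,p_0)\colon\mathcal{O}(-6,-3)\to\mathcal{O}(-4,-2)^3$ of the Koszul complex of $p_0,p_1,p_2$, twisted by $\mathcal{O}(m,n)$. **Proposition 3.2.** For all integers $m,n$: if $m\ge5$ and $n\ge2$, or $m\le5$ and $n\le2$, then ${}''E_2^{0,1}(m,n)=0$. Furthermore, for all integers $m$ and $n$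 the following spaces are finite-dimensional and $$\dim_k{}''E_2^{0,1}(m,1)=\dim_kH^1(m-6,-2)=\begin{cases}m-5&m\ge6\\0&m\le5,\end{cases}$$ $$\dim_k{}''E_2^{0,1}(3,n)=\dim_kH^1(-3,n-3)=\begin{cases}2(n-2)&n\ge3\\0&n\le2,\end{cases}$$ $$\dim_k{}''E_2^{0,1}(4,n)=\dim_kH^1(-2,n-3)=\begin{cases}n-2&n\ge3\\0&n\le2.\end{cases}$$ -/

import Mathlib

namespace BigradedCaseStudy

open MvPolynomial

section Cohomology

variable {k : Type*} [Ring k] {A B C A' B' C' : Type*}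
  [AddCommGroup A] [Module k A] [AddCommGroup B] [Module k B] [AddCommGroup C] [Module k C]
  [AddCommGroup A'] [Module k A'] [AddCommGroup B'] [Module k B'] [AddCommGroup C'] [Module k C']

/-- The cohomology `ker d₁ / im d₀` at the middle term of a complex `A → B → C`. -/
def Cohomology (d₀ : A →ₗ[k] B) (d₁ : B →ₗ[k] C) : Type _ :=
  LinearMap.ker d₁ ⧸ (LinearMap.range d₀).submoduleOf (LinearMap.ker d₁)

instance (d₀ : A →ₗ[k] B) (d₁ : B →ₗ[k] C) : AddCommGroup (Cohomology d₀ d₁) :=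
  inferInstanceAs (AddCommGroup (_ ⧸ (LinearMap.range d₀).submoduleOf (LinearMap.ker d₁)))

instance (d₀ : A →ₗ[k] B) (d₁ : B →ₗ[k] C) : Module k (Cohomology d₀ d₁) :=
  inferInstanceAs (Module k (_ ⧸ (LinearMap.range d₀).submoduleOf (LinearMap.ker d₁)))

/-- The map on cohomology induced by a linear map that respects cocycles and coboundaries. -/
def Cohomology.map {d₀ : A →ₗ[k] B} {d₁ : B →ₗ[k] C} {d₀' : A' →ₗ[k] B'} {d₁' : B' →ₗ[k] C'}
    (f : B →ₗ[k] B') (hker : ∀ b ∈ LinearMap.ker d₁, f b ∈ LinearMap.ker d₁')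
    (hrange : ∀ b ∈ LinearMap.range d₀, f b ∈ LinearMap.range d₀') :
    Cohomology d₀ d₁ →ₗ[k] Cohomology d₀' d₁' :=
  Submodule.mapQ ((LinearMap.range d₀).submoduleOf (LinearMap.ker d₁))
    ((LinearMap.range d₀').submoduleOf (LinearMap.ker d₁')) (f.restrict hker)
    (fun b hb => hrange b.1 hb)

end Cohomology

section Definitions

variable (k : Type*) [Field k]

/-- The polynomial ring `R = k[x, y, z, w]`. The variables `x, y` are `X (Sum.inl 0), X (Sum.inl 1)`
and the variables `z, w` are `X (Sum.inr 0), X (Sum.inr 1)`. -/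
abbrev R : Type _ := MvPolynomial (Fin 2 ⊕ Fin 2) k

/-- The bidegrees of the variables: `x, y` have degree `(1, 0)` and `z, w` have degree `(0, 1)`. -/
def bidegree : Fin 2 ⊕ Fin 2 → ℤ × ℤ :=
  Sum.elim (fun _ => (1, 0)) (fun _ => (0, 1))

/-- The graded piece `R_{m,n}`, for all integers `m, n` (it is zero if `m < 0` or `n < 0`). -/
abbrev gradedPiece (m n : ℤ) : Submodule k (R k) :=
  weightedHomogeneousSubmodule k bidegree (m, n)

/-- The set of points of `ℙ¹ × ℙ¹` over `k`. -/
abbrev P1P1 : Type _ := Projectivization k (Fin 2 → k) × Projectivization k (Fin 2 → k)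

variable {k}

/-- The value of a polynomial at (chosen homogeneous coordinates of) a point of `ℙ¹ × ℙ¹`. For a
bihomogeneous polynomial, whether this value vanishes does not depend on the coordinates. -/
noncomputable def value (P : P1P1 k) (f : R k) : k :=
  MvPolynomial.eval (Sum.elim P.1.rep P.2.rep) f

variable (k)

/-- The field of fractions of `R`. -/
abbrev K : Type _ := FractionRing (R k)

variable {k}

/-- A rational function `s` is a section of `𝒪(m, n)` near `P` if it can be written as `f / g` with
`f, g` bihomogeneous, `deg f - deg g = (m, n)` and `g(P) ≠ 0`. -/
def IsRegularAt (m n : ℤ) (P : P1P1 k) (s : K k) : Prop :=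
  ∃ a b : ℤ, ∃ f ∈ gradedPiece k (m + a) (n + b), ∃ g ∈ gradedPiece k a b,
    value P g ≠ 0 ∧ s = algebraMap (R k) (K k) f / algebraMap (R k) (K k) g

theorem algebraMap_ne_zero_of_value {P : P1P1 k} {g : R k} (hg : value P g ≠ 0) :
    algebraMap (R k) (K k) g ≠ 0 := by
  intro h
  have h0 : g = 0 := (IsFractionRing.injective (R k) (K k)) (by rw [h, map_zero])
  exact hg (by simp [value, h0])

theorem mul_mem_gradedPiece {a b c d e f : ℤ} {p q : R k} (hp : p ∈ gradedPiece k a b)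
    (hq : q ∈ gradedPiece k c d) (he : a + c = e) (hf : b + d = f) :
    p * q ∈ gradedPiece k e f := by
  subst he hf
  rw [mem_weightedHomogeneousSubmodule] at hp hq ⊢
  exact hp.mul hq

theorem one_mem_gradedPiece : (1 : R k) ∈ gradedPiece k 0 0 := by
  rw [mem_weightedHomogeneousSubmodule]
  exact isWeightedHomogeneous_one k bidegree

theorem IsRegularAt.zero (m n : ℤ) (P : P1P1 k) : IsRegularAt m n P 0 :=
  ⟨0, 0, 0, Submodule.zero_mem _, 1, one_mem_gradedPiece, by simp [value], by simp⟩

theorem IsRegularAt.add {m n : ℤ} {P : P1P1 k} {s t : K k} (hs : IsRegularAt m n P s)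
    (ht : IsRegularAt m n P t) : IsRegularAt m n P (s + t) := by
  obtain ⟨a, b, f, hf, g, hg, hgP, rfl⟩ := hs
  obtain ⟨a', b', f', hf', g', hg', hgP', rfl⟩ := ht
  refine ⟨a + a', b + b', f * g' + g * f', Submodule.add_mem _
    (mul_mem_gradedPiece hf hg' (by omega) (by omega))
    (mul_mem_gradedPiece hg hf' (by omega) (by omega)), g * g',
    mul_mem_gradedPiece hg hg' rfl rfl, ?_, ?_⟩
  · simpa [value] using And.intro hgP hgP'
  · rw [div_add_div _ _ (algebraMap_ne_zero_of_value hgP) (algebraMap_ne_zero_of_value hgP')]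
    simp only [map_add, map_mul]

theorem IsRegularAt.mul {m n d e m' n' : ℤ} {P : P1P1 k} {s : K k} {p : R k}
    (hp : p ∈ gradedPiece k d e) (hm : m + d = m') (hn : n + e = n') (hs : IsRegularAt m n P s) :
    IsRegularAt m' n' P (algebraMap (R k) (K k) p * s) := by
  obtain ⟨a, b, f, hf, g, hg, hgP, rfl⟩ := hs
  exact ⟨a, b, p * f, mul_mem_gradedPiece hp hf (by omega) (by omega), g, hg, hgP, by
    rw [map_mul, mul_div_assoc]⟩

theorem IsRegularAt.smul {m n : ℤ} {P : P1P1 k} {s : K k} (c : k) (hs : IsRegularAt m n P s) :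
    IsRegularAt m n P (c • s) := by
  obtain ⟨a, b, f, hf, g, hg, hgP, rfl⟩ := hs
  refine ⟨a, b, c • f, Submodule.smul_mem _ c hf, g, hg, hgP, ?_⟩
  rw [Algebra.smul_def c f, map_mul, ← mul_div_assoc', Algebra.smul_def,
    IsScalarTower.algebraMap_apply k (R k) (K k)]

/-- The sections `Γ(U, 𝒪(m, n))` of the line bundle `𝒪(m, n)` on a nonempty Zariski open subset `U`
of `ℙ¹ × ℙ¹`, as a `k`-subspace of the field of fractions of `R`: the rational functions that are
near each point of `U` a quotient of bihomogeneous polynomials of degree difference `(m, n)`, with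
denominator not vanishing at that point. Restriction maps are inclusions. -/
noncomputable def sections (m n : ℤ) (U : Set (P1P1 k)) : Submodule k (K k) where
  carrier := {s | ∀ P ∈ U, IsRegularAt m n P s}
  add_mem' hs ht P hP := (hs P hP).add (ht P hP)
  zero_mem' P _ := IsRegularAt.zero m n P
  smul_mem' c _ hs P hP := (hs P hP).smul c

theorem sections_mono (m n : ℤ) {U V : Set (P1P1 k)} (h : V ⊆ U) :
    sections m n U ≤ sections m n V :=
  fun _ hs P hP => hs P (h hP)

/-- The restriction map `Γ(U, 𝒪(m, n)) → Γ(V, 𝒪(m, n))`. -/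
noncomputable abbrev res (m n : ℤ) {U V : Set (P1P1 k)} (h : V ⊆ U) :
    sections m n U →ₗ[k] sections m n V :=
  Submodule.inclusion (sections_mono m n h)

/-- The affine open cover of `ℙ¹ × ℙ¹` by the four sets `{x ≠ 0, z ≠ 0}`, `{x ≠ 0, w ≠ 0}`,
`{y ≠ 0, z ≠ 0}` and `{y ≠ 0, w ≠ 0}`. -/
def cover (i : Fin 2 × Fin 2) : Set (P1P1 k) :=
  {P | P.1.rep i.1 ≠ 0 ∧ P.2.rep i.2 ≠ 0}

variable (k)

/-- Čech `0`-cochains of `𝒪(m, n)` for the affine cover. -/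
abbrev C0 (m n : ℤ) : Type _ :=
  ∀ i : Fin 2 × Fin 2, sections (k := k) m n (cover i)

/-- Čech `1`-cochains of `𝒪(m, n)` for the affine cover. -/
abbrev C1 (m n : ℤ) : Type _ :=
  ∀ i j : Fin 2 × Fin 2, sections (k := k) m n (cover i ∩ cover j)

/-- Čech `2`-cochains of `𝒪(m, n)` for the affine cover. -/
abbrev C2 (m n : ℤ) : Type _ :=
  ∀ i j l : Fin 2 × Fin 2, sections (k := k) m n (cover i ∩ cover j ∩ cover l)

/-- The Čech differential `(δα)_{ij} = α_j - α_i`. -/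
noncomputable def δ0 (m n : ℤ) : C0 k m n →ₗ[k] C1 k m n :=
  LinearMap.pi fun i => LinearMap.pi fun j =>
    res m n Set.inter_subset_right ∘ₗ LinearMap.proj j
      - res m n Set.inter_subset_left ∘ₗ LinearMap.proj i

/-- The Čech differential `(δφ)_{ijl} = φ_{jl} - φ_{il} + φ_{ij}`. -/
noncomputable def δ1 (m n : ℤ) : C1 k m n →ₗ[k] C2 k m n :=
  LinearMap.pi fun i => LinearMap.pi fun j => LinearMap.pi fun l =>
    res m n (Set.inter_subset_inter_left _ Set.inter_subset_right) ∘ₗ LinearMap.proj l ∘ₗ LinearMap.proj j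
      - res m n (Set.inter_subset_inter_left _ Set.inter_subset_left) ∘ₗ LinearMap.proj l ∘ₗ LinearMap.proj i
      + res m n Set.inter_subset_left ∘ₗ LinearMap.proj j ∘ₗ LinearMap.proj i

/-- The cohomology group `H¹(m, n) = H¹(ℙ¹ × ℙ¹, 𝒪(m, n))`, computed as Čech cohomology of the
affine cover: `1`-cocycles modulo `1`-coboundaries. -/
abbrev H1 (m n : ℤ) : Type _ :=
  Cohomology (δ0 k m n) (δ1 k m n)

variable {k}

/-- Multiplication by a bihomogeneous polynomial `p` of degree `(d, e)`, as a map
`Γ(U, 𝒪(m, n)) → Γ(U, 𝒪(m + d, n + e))`. -/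
noncomputable def mulSections {d e m n m' n' : ℤ} (p : R k) (hp : p ∈ gradedPiece k d e)
    (hm : m + d = m') (hn : n + e = n') (U : Set (P1P1 k)) :
    sections m n U →ₗ[k] sections m' n' U :=
  (LinearMap.mulLeft k (algebraMap (R k) (K k) p)).restrict
    (fun _ hs P hP => (hs P hP).mul hp hm hn)

/-- Multiplication by `p` on Čech `1`-cochains. -/
noncomputable def mulC1 {d e m n m' n' : ℤ} (p : R k) (hp : p ∈ gradedPiece k d e)
    (hm : m + d = m') (hn : n + e = n') : C1 k m n →ₗ[k] C1 k m' n' :=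
  LinearMap.pi fun i => LinearMap.pi fun j =>
    mulSections p hp hm hn (cover i ∩ cover j) ∘ₗ LinearMap.proj j ∘ₗ LinearMap.proj i

theorem mulC1_mem_ker {d e m n m' n' : ℤ} (p : R k) (hp : p ∈ gradedPiece k d e)
    (hm : m + d = m') (hn : n + e = n') (φ : C1 k m n) (hφ : φ ∈ LinearMap.ker (δ1 k m n)) :
    mulC1 p hp hm hn φ ∈ LinearMap.ker (δ1 k m' n') := by
  rw [LinearMap.mem_ker] at hφ ⊢
  funext i j l
  have h : (δ1 k m n φ i j l : K k) = 0 := by rw [hφ]; rfl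
  apply Subtype.ext
  change (φ j l : K k) - φ i l + φ i j = 0 at h
  change algebraMap (R k) (K k) p * (φ j l : K k) - algebraMap (R k) (K k) p * (φ i l : K k)
    + algebraMap (R k) (K k) p * (φ i j : K k) = 0
  rw [← mul_sub, ← mul_add, h, mul_zero]

theorem mulC1_mem_range {d e m n m' n' : ℤ} (p : R k) (hp : p ∈ gradedPiece k d e)
    (hm : m + d = m') (hn : n + e = n') (φ : C1 k m n) (hφ : φ ∈ LinearMap.range (δ0 k m n)) :
    mulC1 p hp hm hn φ ∈ LinearMap.range (δ0 k m' n') := by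
  obtain ⟨α, rfl⟩ := hφ
  refine ⟨fun i => mulSections p hp hm hn (cover i) (α i), ?_⟩
  funext i j
  apply Subtype.ext
  change algebraMap (R k) (K k) p * (α j : K k) - algebraMap (R k) (K k) p * (α i : K k)
    = algebraMap (R k) (K k) p * ((α j : K k) - (α i : K k))
  rw [mul_sub]

/-- The map `H¹(m, n) → H¹(m + d, n + e)` induced by multiplication by a bihomogeneous polynomial
`p` of degree `(d, e)`. -/
noncomputable def mulH1 {d e m n m' n' : ℤ} (p : R k) (hp : p ∈ gradedPiece k d e)
    (hm : m + d = m') (hn : n + e = n') : H1 k m n →ₗ[k] H1 k m' n' :=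
  Cohomology.map (mulC1 p hp hm hn) (mulC1_mem_ker p hp hm hn) (mulC1_mem_range p hp hm hn)

/-- The map `d₁ : H¹(m - 6, n - 3) → H¹(m - 4, n - 2)³` induced by the first map
`(p₂, -p₁, p₀)` of the Koszul complex of `p₀, p₁, p₂ ∈ R_{2,1}`. -/
noncomputable def d1 (p : Fin 3 → R k) (hp : ∀ i, p i ∈ gradedPiece k 2 1) (m n : ℤ) :
    H1 k (m - 6) (n - 3) →ₗ[k] (Fin 3 → H1 k (m - 4) (n - 2)) :=
  LinearMap.pi
    ![mulH1 (p 2) (hp 2) (by omega) (by omega),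
      -mulH1 (p 1) (hp 1) (by omega) (by omega),
      mulH1 (p 0) (hp 0) (by omega) (by omega)]

/-- The term `''E₂^{0,1}(m, n) = ker (d₁ : H¹(m - 6, n - 3) → H¹(m - 4, n - 2)³)`. -/
noncomputable def E2 (p : Fin 3 → R k) (hp : ∀ i, p i ∈ gradedPiece k 2 1) (m n : ℤ) :
    Submodule k (H1 k (m - 6) (n - 3)) :=
  LinearMap.ker (d1 p hp m n)

end Definitions

end BigradedCaseStudy

/-!
The sections of `𝒪(m, n)` over an intersection of two of the four charts form the span of the Laurent
monomials of degree `(m, n)` in which only variables invertible there occur with a negative exponent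
(`sections_cover_inter`: the Nullstellensatz and unique factorization control the denominators).
Since Laurent monomials are linearly independent over `k`, the Čech complex splits according to
exponents, and for a single exponent `e` the question is which functions on pairs of charts are
coboundaries. If the entries of `e` that are negative are exactly those of `x, y`, or exactly those
of `z, w`, a cocycle has one free parameter and there are no coboundaries; for every other sign
pattern each cocycle is the coboundary of its values on the pairs that contain a suitable base chart
(`cocycle_baseChart_eq_zero`). Hence `H¹(m, n)` has a basis indexed by the exponents of degree
`(m, n)` of the two special patterns (`H1Equiv`). Counting them gives the Künneth formula
`dim H¹(m, n) = h¹(m) h⁰(n) + h⁰(m) h¹(n)` on `ℙ¹ × ℙ¹` (`finrank_H1`).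

The asserted vanishing of `''E₂^{0,1}(m, n)` is that of the source of `d₁`, and in the three families
of dimensions the source or the target of `d₁` is zero, so that the kernel is the whole source.
-/

namespace BigradedCaseStudy

open MvPolynomial

/-! ### Laurent monomials in the fraction field -/

section Laurent

/-- The bidegree of the Laurent monomial with exponent vector `e`. -/
def exponentDegree (e : Fin 2 ⊕ Fin 2 → ℤ) : ℤ × ℤ :=
  (e (Sum.inl 0) + e (Sum.inl 1), e (Sum.inr 0) + e (Sum.inr 1))

theorem weight_bidegree (d : Fin 2 ⊕ Fin 2 →₀ ℕ) :
    Finsupp.weight bidegree d = exponentDegree (fun v => (d v : ℤ)) := by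
  rw [Finsupp.weight_apply, Finsupp.sum_fintype _ _ (by simp)]
  simp only [Fintype.sum_sum_type, Fin.sum_univ_two, bidegree, exponentDegree, Sum.elim_inl,
    Sum.elim_inr, Prod.smul_mk, Prod.mk_add_mk]
  simp

variable (k : Type*) [Field k]

/-- The Laurent monomial `x^a y^b z^c w^d` as a rational function. -/
noncomputable def laurentMonomial (e : Fin 2 ⊕ Fin 2 → ℤ) : K k :=
  ∏ v, algebraMap (R k) (K k) (X v) ^ e v

variable {k}

theorem algebraMap_X_ne_zero (v : Fin 2 ⊕ Fin 2) : algebraMap (R k) (K k) (X v) ≠ 0 := by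
  simp [X_ne_zero]

theorem laurentMonomial_add (e f : Fin 2 ⊕ Fin 2 → ℤ) :
    laurentMonomial k (e + f) = laurentMonomial k e * laurentMonomial k f := by
  simp only [laurentMonomial, ← Finset.prod_mul_distrib, Pi.add_apply]
  exact Finset.prod_congr rfl fun v _ => zpow_add₀ (algebraMap_X_ne_zero v) _ _

theorem laurentMonomial_ne_zero (e : Fin 2 ⊕ Fin 2 → ℤ) : laurentMonomial k e ≠ 0 :=
  Finset.prod_ne_zero_iff.2 fun v _ => zpow_ne_zero _ (algebraMap_X_ne_zero v)

theorem laurentMonomial_natCast (d : Fin 2 ⊕ Fin 2 →₀ ℕ) :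
    laurentMonomial k (fun v => (d v : ℤ)) = algebraMap (R k) (K k) (monomial d 1) := by
  rw [monomial_eq, C_1, one_mul, Finsupp.prod_fintype _ _ (by simp), map_prod]
  simp [laurentMonomial]

theorem algebraMap_eq_sum_laurentMonomial (F : R k) :
    algebraMap (R k) (K k) F
      = ∑ d ∈ F.support, coeff d F • laurentMonomial k (fun v => (d v : ℤ)) := by
  conv_lhs => rw [F.as_sum, map_sum]
  refine Finset.sum_congr rfl fun d _ => ?_
  rw [laurentMonomial_natCast, ← mul_one (coeff d F), ← smul_eq_mul, ← smul_monomial,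
    ← IsScalarTower.coe_toAlgHom' k (R k) (K k), map_smul, smul_eq_mul, mul_one]

theorem linearIndependent_laurentMonomial :
    LinearIndependent k (laurentMonomial k) := by
  rw [linearIndependent_iff']
  intro s g hg e he
  -- Multiplying by a large monomial turns the relation into one between ordinary monomials.
  let N : Fin 2 ⊕ Fin 2 → ℤ := fun v => ∑ e ∈ s, |e v|
  have hN : ∀ e ∈ s, ∀ v, 0 ≤ e v + N v := fun e he v => by
    have h1 : |e v| ≤ N v := Finset.single_le_sum (f := fun e : Fin 2 ⊕ Fin 2 → ℤ => |e v|)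
      (fun _ _ => abs_nonneg _) he
    have h2 := neg_abs_le (e v)
    omega
  let t : (Fin 2 ⊕ Fin 2 → ℤ) → (Fin 2 ⊕ Fin 2 →₀ ℕ) := fun e =>
    Finsupp.equivFunOnFinite.symm fun v => (e v + N v).toNat
  have ht : ∀ e ∈ s, e + N = fun v => ((t e v : ℕ) : ℤ) := fun e he => by
    funext v
    simp [t, hN e he v]
  have h0 : algebraMap (R k) (K k) (∑ e ∈ s, monomial (t e) (g e)) = 0 := by
    have h1 : (∑ e ∈ s, g e • laurentMonomial k e) * laurentMonomial k N = 0 := by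
      rw [hg, zero_mul]
    rw [← h1, map_sum, Finset.sum_mul]
    refine Finset.sum_congr rfl fun e he => ?_
    rw [smul_mul_assoc, ← laurentMonomial_add, ht e he, laurentMonomial_natCast,
      ← IsScalarTower.coe_toAlgHom' k (R k) (K k), ← map_smul, smul_monomial, smul_eq_mul, mul_one]
  have h1 : ∑ e ∈ s, monomial (t e) (g e) = 0 :=
    IsFractionRing.injective (R k) (K k) (by rw [h0, map_zero])
  have h2 := congrArg (coeff (t e)) h1
  rw [coeff_sum, Finset.sum_eq_single_of_mem e he, coeff_monomial, if_pos rfl, coeff_zero] at h2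
  · exact h2
  · intro f hf hfe
    rw [coeff_monomial, if_neg]
    intro h
    apply hfe
    have h3 : f + N = e + N := by rw [ht f hf, ht e he, h]
    exact add_right_cancel h3

end Laurent

/-! ### Sections over intersections of two charts -/

section Sections

/-- The variables `v` that have no zero on the intersection of the charts `i` and `j`. -/
def InvertibleOn (i j : Fin 2 × Fin 2) : Fin 2 ⊕ Fin 2 → Prop :=
  Sum.elim (fun a => a = i.1 ∨ a = j.1) (fun c => c = i.2 ∨ c = j.2)

/-- The exponents of the Laurent monomials that are regular on the intersection of the charts
`i` and `j`. -/
def RegularExponent (i j : Fin 2 × Fin 2) (e : Fin 2 ⊕ Fin 2 → ℤ) : Prop :=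
  ∀ v, e v < 0 → InvertibleOn i j v

variable {k : Type*} [Field k]

theorem mem_cover_inter {i j : Fin 2 × Fin 2} {P : P1P1 k} :
    P ∈ cover i ∩ cover j ↔
      ∀ v, InvertibleOn i j v → Sum.elim P.1.rep P.2.rep v ≠ 0 := by
  constructor
  · rintro ⟨⟨h1, h2⟩, h3, h4⟩ (v | v) hv
    · rcases hv with h | h <;> subst h <;> assumption
    · rcases hv with h | h <;> subst h <;> assumption
  · intro h
    exact ⟨⟨h (Sum.inl i.1) (Or.inl rfl), h (Sum.inr i.2) (Or.inl rfl)⟩,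
      h (Sum.inl j.1) (Or.inr rfl), h (Sum.inr j.2) (Or.inr rfl)⟩

theorem monomial_mem_gradedPiece (d : Fin 2 ⊕ Fin 2 →₀ ℕ) {a b : ℤ}
    (h : exponentDegree (fun v => (d v : ℤ)) = (a, b)) :
    (monomial d 1 : R k) ∈ gradedPiece k a b := by
  rw [mem_weightedHomogeneousSubmodule]
  exact isWeightedHomogeneous_monomial _ _ _ (by rw [weight_bidegree, h])

theorem laurentMonomial_mem_sections {m n : ℤ} {i j : Fin 2 × Fin 2}
    {e : Fin 2 ⊕ Fin 2 → ℤ} (hd : exponentDegree e = (m, n)) (he : RegularExponent i j e) :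
    laurentMonomial k e ∈ sections (k := k) m n (cover i ∩ cover j) := by
  intro P hP
  let f : Fin 2 ⊕ Fin 2 →₀ ℕ := Finsupp.equivFunOnFinite.symm fun v => (e v).toNat
  let g : Fin 2 ⊕ Fin 2 →₀ ℕ := Finsupp.equivFunOnFinite.symm fun v => (-e v).toNat
  have hfg : (fun v => (f v : ℤ)) = e + fun v => (g v : ℤ) := by
    funext v
    simp only [f, g, Finsupp.equivFunOnFinite_symm_apply_apply, Pi.add_apply]
    omega
  have hdeg : exponentDegree (fun v => (f v : ℤ))
      = exponentDegree e + exponentDegree (fun v => (g v : ℤ)) := by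
    rw [hfg]
    simp only [exponentDegree, Pi.add_apply, Prod.mk_add_mk, Prod.mk.injEq]
    constructor <;> ring
  refine ⟨(exponentDegree fun v => (g v : ℤ)).1, (exponentDegree fun v => (g v : ℤ)).2,
    monomial f 1, monomial_mem_gradedPiece f (by rw [hdeg, hd]; rfl), monomial g 1,
    monomial_mem_gradedPiece g rfl, ?_, ?_⟩
  · rw [value, eval_monomial, one_mul, Finsupp.prod_fintype _ _ (by simp)]
    refine Finset.prod_ne_zero_iff.2 fun v _ => ?_
    by_cases hv : e v < 0
    · exact pow_ne_zero _ (mem_cover_inter.1 hP v (he v hv))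
    · have : g v = 0 := by
        simp only [g, Finsupp.equivFunOnFinite_symm_apply_apply]
        omega
      simp [this]
  · rw [← laurentMonomial_natCast, ← laurentMonomial_natCast, hfg, laurentMonomial_add,
      eq_div_iff (laurentMonomial_ne_zero _)]

/-- A bihomogeneous polynomial that does not vanish at a multiple of a pair of vectors does not
vanish at the pair itself. -/
theorem eval_ne_zero_of_eval_smul_ne_zero {a b : ℤ} {g : R k} (hg : g ∈ gradedPiece k a b)
    (u₁ u₂ : Fin 2 → k) (c₁ c₂ : kˣ)
    (h : eval (Sum.elim (c₁ • u₁) (c₂ • u₂)) g ≠ 0) : eval (Sum.elim u₁ u₂) g ≠ 0 := by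
  have key : eval (Sum.elim (c₁ • u₁) (c₂ • u₂)) g
      = (c₁ : k) ^ a * (c₂ : k) ^ b * eval (Sum.elim u₁ u₂) g := by
    rw [eval_eq', eval_eq', Finset.mul_sum]
    refine Finset.sum_congr rfl fun d hd => ?_
    have hd' := hg (mem_support_iff.1 hd)
    rw [weight_bidegree, exponentDegree, Prod.mk.injEq] at hd'
    rw [← hd'.1, ← hd'.2, zpow_add₀ c₁.ne_zero, zpow_add₀ c₂.ne_zero]
    simp only [Fintype.prod_sum_type, Fin.prod_univ_two, Sum.elim_inl, Sum.elim_inr,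
      Pi.smul_apply, Units.smul_def, smul_eq_mul, mul_pow, zpow_natCast]
    ring
  intro h0
  exact h (by rw [key, h0, mul_zero])

/-- If a multiple of `F` by a nonzero bihomogeneous polynomial is bihomogeneous, so is `F`. -/
theorem mem_gradedPiece_of_mul_mem {F g : R k} {a b m n : ℤ} (hg : g ∈ gradedPiece k a b)
    (hg0 : g ≠ 0) (h : F * g ∈ gradedPiece k (m + a) (n + b)) : F ∈ gradedPiece k m n := by
  classical
  let : GradedAlgebra (weightedHomogeneousSubmodule k bidegree) := weightedGradedAlgebra k bidegree
  have h1 := DirectSum.coe_decompose_mul_add_of_right_mem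
    (weightedHomogeneousSubmodule k bidegree) (i := (m, n)) (a := F) hg
  rw [Prod.mk_add_mk, DirectSum.decompose_of_mem_same
    (weightedHomogeneousSubmodule k bidegree) h] at h1
  rw [mul_right_cancel₀ hg0 h1]
  exact SetLike.coe_mem _

/-- The sections of `𝒪(m, n)` over the intersection of two charts are the linear combinations of
the Laurent monomials of degree `(m, n)` that are regular there. By the Nullstellensatz, the reduced
denominator of a section divides a power of the product of the variables invertible on the
intersection. -/
theorem sections_cover_inter [IsAlgClosed k] (m n : ℤ) (i j : Fin 2 × Fin 2) :
    sections (k := k) m n (cover i ∩ cover j)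
      = Submodule.span k
          (laurentMonomial k '' {e | exponentDegree e = (m, n) ∧ RegularExponent i j e}) := by
  classical
  apply le_antisymm
  swap
  · rw [Submodule.span_le]
    rintro _ ⟨e, ⟨hd, he⟩, rfl⟩
    exact laurentMonomial_mem_sections hd he
  intro s hs
  obtain ⟨f₀, ⟨g₀, hg₀⟩, hrel, hs0⟩ := IsFractionRing.exists_reduced_fraction (R k) s
  have hg₀0 : g₀ ≠ 0 := nonZeroDivisors.ne_zero hg₀
  rw [IsFractionRing.mk'_eq_div] at hs0
  have hinj := IsFractionRing.injective (R k) (K k)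
  have hg₀' : algebraMap (R k) (K k) g₀ ≠ 0 := by simpa using hg₀0
  let c : Fin 2 ⊕ Fin 2 →₀ ℕ :=
    Finsupp.equivFunOnFinite.symm fun v => if InvertibleOn i j v then 1 else 0
  have hc : ∀ v, c v = if InvertibleOn i j v then 1 else 0 := fun v => rfl
  -- near each point of the intersection, `s` has a bihomogeneous denominator divisible by `g₀`
  have hdvd : ∀ P ∈ cover (k := k) i ∩ cover j, ∃ a b : ℤ, ∃ f ∈ gradedPiece k (m + a) (n + b),
      ∃ g ∈ gradedPiece k a b, value P g ≠ 0 ∧ f₀ * g = f * g₀ ∧ g₀ ∣ g := by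
    intro P hP
    obtain ⟨a, b, f, hf, g, hg, hgP, hsg⟩ := hs P hP
    have h1 : f₀ * g = f * g₀ := by
      apply hinj
      rw [map_mul, map_mul, ← div_eq_div_iff hg₀' (algebraMap_ne_zero_of_value hgP), hs0, hsg]
    exact ⟨a, b, f, hf, g, hg, hgP, h1,
      hrel.symm.dvd_of_dvd_mul_left (Dvd.intro_left f h1.symm)⟩
  have hpoint : ∀ u : Fin 2 ⊕ Fin 2 → k, (∀ v, InvertibleOn i j v → u v ≠ 0) →
      ∃ P ∈ cover (k := k) i ∩ cover j, ∃ c₁ c₂ : kˣ,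
        P.1.rep = c₁ • (u ∘ Sum.inl) ∧ P.2.rep = c₂ • (u ∘ Sum.inr) := by
    intro u hu
    have hu1 : u ∘ Sum.inl ≠ 0 := fun h => hu (Sum.inl i.1) (Or.inl rfl) (congrFun h i.1)
    have hu2 : u ∘ Sum.inr ≠ 0 := fun h => hu (Sum.inr i.2) (Or.inl rfl) (congrFun h i.2)
    obtain ⟨c₁, hc₁⟩ := Projectivization.exists_smul_eq_mk_rep k _ hu1
    obtain ⟨c₂, hc₂⟩ := Projectivization.exists_smul_eq_mk_rep k _ hu2
    refine ⟨(.mk k _ hu1, .mk k _ hu2), mem_cover_inter.2 ?_, c₁, c₂, hc₁.symm, hc₂.symm⟩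
    rintro (v | v) hv
    · simpa [← hc₁, Units.smul_def] using hu _ hv
    · simpa [← hc₂, Units.smul_def] using hu _ hv
  have hnull : ∃ N : ℕ, g₀ ∣ (monomial c 1 : R k) ^ N := by
    have hmem : (monomial c 1 : R k) ∈ (Ideal.span {g₀}).radical := by
      rw [← vanishingIdeal_zeroLocus_eq_radical (K := k), mem_vanishingIdeal_iff]
      intro u hu
      have hug : eval u g₀ = 0 := by
        simpa [aeval_eq_eval] using hu g₀ (Ideal.mem_span_singleton_self g₀)
      by_contra hne
      have hu' : ∀ v, InvertibleOn i j v → u v ≠ 0 := by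
        rw [aeval_eq_eval, eval_monomial, one_mul,
          Finsupp.prod_fintype _ _ (by simp)] at hne
        intro v hv
        have := Finset.prod_ne_zero_iff.1 hne v (Finset.mem_univ v)
        simpa [hc, hv] using this
      obtain ⟨P, hP, c₁, c₂, h1, h2⟩ := hpoint u hu'
      obtain ⟨a, b, f, -, g, hg, hgP, -, q, rfl⟩ := hdvd P hP
      rw [value, h1, h2] at hgP
      have := eval_ne_zero_of_eval_smul_ne_zero hg _ _ c₁ c₂ hgP
      rw [Sum.elim_comp_inl_inr, map_mul, hug, zero_mul] at this
      exact this rfl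
    obtain ⟨N, hN⟩ := hmem
    exact ⟨N, Ideal.mem_span_singleton.1 hN⟩
  obtain ⟨N, q, hq⟩ := hnull
  obtain ⟨P, hP, -⟩ := hpoint (fun _ => 1) (fun _ _ => one_ne_zero)
  obtain ⟨a, b, f, hf, g, hg, hgP, hfg, -⟩ := hdvd P hP
  have hmon : (monomial c 1 : R k) ^ N = monomial (N • c) 1 := by
    rw [monomial_pow, one_pow]
  obtain ⟨A, B, hAB⟩ : ∃ A B : ℤ, exponentDegree (fun v => ((N • c) v : ℤ)) = (A, B) :=
    ⟨_, _, rfl⟩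
  -- `s` is the quotient of `f₀ * q` by the `N`-th power of the product of the invertible variables
  have hF : f₀ * q ∈ gradedPiece k (m + A) (n + B) := by
    refine mem_gradedPiece_of_mul_mem hg (fun h => hgP (by simp [h, value])) ?_
    have : f₀ * q * g = f * monomial (N • c) 1 := by
      rw [← hmon, hq, mul_right_comm, hfg]; ring
    rw [this]
    exact mul_mem_gradedPiece hf (monomial_mem_gradedPiece _ hAB) (by ring) (by ring)
  have hsF : s = algebraMap (R k) (K k) (f₀ * q)
      * laurentMonomial k (-fun v => ((N • c) v : ℤ)) := by
    have h1 : laurentMonomial k (-fun v => ((N • c) v : ℤ))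
        * algebraMap (R k) (K k) (g₀ * q) = 1 := by
      rw [← hq, hmon, ← laurentMonomial_natCast, ← laurentMonomial_add, neg_add_cancel]
      simp [laurentMonomial]
    rw [← hs0, div_eq_iff hg₀', ← mul_one (algebraMap (R k) (K k) f₀), ← h1, map_mul, map_mul]
    ring
  rw [hsF, algebraMap_eq_sum_laurentMonomial, Finset.sum_mul]
  refine Submodule.sum_mem _ fun d hd => ?_
  rw [smul_mul_assoc, ← laurentMonomial_add]
  refine Submodule.smul_mem _ _ (Submodule.subset_span ⟨_, ⟨?_, ?_⟩, rfl⟩)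
  · have hd' := hF (mem_support_iff.1 hd)
    rw [weight_bidegree] at hd'
    simp only [exponentDegree, Prod.mk.injEq, Pi.add_apply, Pi.neg_apply] at hd' hAB ⊢
    omega
  · intro v hv
    by_contra hni
    simp [hc, hni] at hv
    omega

end Sections

/-! ### Coefficients of Laurent expansions -/

section Coefficients

variable (k : Type*) [Field k]

/-- A `k`-linear left inverse of the inclusion of the Laurent polynomials into the field of
fractions. It is canonical only on Laurent polynomials, which include all sections over
intersections of charts; on other rational functions it is arbitrary. -/
noncomputable def laurentExpansion : K k →ₗ[k] ((Fin 2 ⊕ Fin 2 → ℤ) →₀ k) :=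
  (LinearMap.exists_leftInverse_of_injective (Finsupp.linearCombination k (laurentMonomial k))
    (LinearMap.ker_eq_bot.2 linearIndependent_laurentMonomial)).choose

variable {k}

theorem laurentExpansion_linearCombination (f : (Fin 2 ⊕ Fin 2 → ℤ) →₀ k) :
    laurentExpansion k (Finsupp.linearCombination k (laurentMonomial k) f) = f :=
  LinearMap.congr_fun (LinearMap.exists_leftInverse_of_injective
    (Finsupp.linearCombination k (laurentMonomial k))
    (LinearMap.ker_eq_bot.2 linearIndependent_laurentMonomial)).choose_spec f

theorem laurentExpansion_laurentMonomial (e : Fin 2 ⊕ Fin 2 → ℤ) :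
    laurentExpansion k (laurentMonomial k e) = Finsupp.single e 1 := by
  simpa using laurentExpansion_linearCombination (Finsupp.single e (1 : k))

theorem mem_sections_iff [IsAlgClosed k] {m n : ℤ} {i j : Fin 2 × Fin 2} {s : K k} :
    s ∈ sections (k := k) m n (cover i ∩ cover j) ↔
      Finsupp.linearCombination k (laurentMonomial k) (laurentExpansion k s) = s ∧
        ∀ e, laurentExpansion k s e ≠ 0 → exponentDegree e = (m, n) ∧ RegularExponent i j e := by
  rw [sections_cover_inter, Finsupp.mem_span_image_iff_linearCombination]
  constructor
  · rintro ⟨f, hf, rfl⟩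
    rw [laurentExpansion_linearCombination]
    exact ⟨rfl, fun e he => hf (Finsupp.mem_support_iff.2 he)⟩
  · rintro ⟨h1, h2⟩
    exact ⟨_, fun e he => h2 e (Finsupp.mem_support_iff.1 he), h1⟩

theorem laurentExpansion_ne_zero_of_mem [IsAlgClosed k] {m n : ℤ} {i j : Fin 2 × Fin 2} {s : K k}
    (hs : s ∈ sections (k := k) m n (cover i ∩ cover j)) {e : Fin 2 ⊕ Fin 2 → ℤ}
    (he : laurentExpansion k s e ≠ 0) : exponentDegree e = (m, n) ∧ RegularExponent i j e :=
  (mem_sections_iff.1 hs).2 e he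

end Coefficients

/-! ### The Čech complex in a fixed exponent -/

section Combinatorics

/-- The exponents of degree `(m, n)` whose set of negative entries is `{x, y}` or `{z, w}`. They
index a basis of `H¹(m, n)`: the corresponding monomials are regular on no chart, and the graph of
the pairs of charts on whose intersection they are not regular is disconnected. -/
def obstructedExponents (m n : ℤ) : Set (Fin 2 ⊕ Fin 2 → ℤ) :=
  {e | exponentDegree e = (m, n) ∧
    ((∀ a, e (Sum.inl a) < 0) ∧ (∀ c, 0 ≤ e (Sum.inr c)) ∨
      (∀ a, 0 ≤ e (Sum.inl a)) ∧ (∀ c, e (Sum.inr c) < 0))}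

/-- For an obstructed exponent, a chart separated from the chart `(0, 0)` in the graph of the pairs
of charts on whose intersection the monomial is not regular. -/
def farChart (e : Fin 2 ⊕ Fin 2 → ℤ) : Fin 2 × Fin 2 :=
  if e (Sum.inl 0) < 0 then (1, 0) else (0, 1)

/-- A chart on which the first variable of each `ℙ¹` occurring with negative exponent in `e` is not
invertible. If the monomial is regular on some chart, none of the variables with negative exponent
is invertible on this one. -/
def baseChart (e : Fin 2 ⊕ Fin 2 → ℤ) : Fin 2 × Fin 2 :=
  (if e (Sum.inl 0) < 0 then 1 else 0, if e (Sum.inr 0) < 0 then 1 else 0)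

variable {k : Type*} [AddCommGroup k]

theorem eq_sub_of_cocycle {ι : Type*} {ψ : ι → ι → k}
    (hψ : ∀ i j l, ψ j l - ψ i l + ψ i j = 0) (o i j : ι) : ψ i j = ψ o j - ψ o i := by
  rw [← sub_eq_zero, ← hψ o i j]
  abel

theorem regularExponent_iff {i j : Fin 2 × Fin 2} {e : Fin 2 ⊕ Fin 2 → ℤ} :
    RegularExponent i j e ↔ (∀ a, e (Sum.inl a) < 0 → a = i.1 ∨ a = j.1) ∧
      (∀ c, e (Sum.inr c) < 0 → c = i.2 ∨ c = j.2) := by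
  simp only [RegularExponent, Sum.forall]
  rfl

/-- The values `i ↦ ψ (baseChart e) i` of the `e`-component `ψ` of a `1`-cocycle form a `0`-cochain,
that is, they vanish on the charts where the monomial is not regular, provided that for obstructed
`e` the coefficient comparing `farChart e` to `(0, 0)` vanishes. -/
theorem cocycle_baseChart_eq_zero {m n : ℤ} {e : Fin 2 ⊕ Fin 2 → ℤ}
    (hd : exponentDegree e = (m, n)) {ψ : Fin 2 × Fin 2 → Fin 2 × Fin 2 → k}
    (hψ : ∀ i j l, ψ j l - ψ i l + ψ i j = 0) (hreg : ∀ i j, ¬ RegularExponent i j e → ψ i j = 0)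
    (hobs : e ∈ obstructedExponents m n → ψ (0, 0) (farChart e) = 0)
    (i : Fin 2 × Fin 2) (hi : ¬ RegularExponent i i e) : ψ (baseChart e) i = 0 := by
  -- The cocycle is the coboundary of `β`; where it vanishes, two values of `β` agree.
  obtain ⟨β, hβ⟩ : ∃ β : Fin 2 × Fin 2 → k, ∀ i j, ψ i j = β j - β i :=
    ⟨ψ (0, 0), eq_sub_of_cocycle hψ (0, 0)⟩
  simp only [hβ, sub_eq_zero, regularExponent_iff, obstructedExponents, Set.mem_ofPred_eq, hd,
    true_and, ← not_lt, Fin.forall_fin_two, Prod.forall, farChart, baseChart] at hreg hobs hi ⊢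
  clear hβ hψ hd
  obtain ⟨i, i'⟩ := i
  by_cases h0 : e (Sum.inl 0) < 0 <;> by_cases h1 : e (Sum.inl 1) < 0 <;>
    by_cases h2 : e (Sum.inr 0) < 0 <;> by_cases h3 : e (Sum.inr 1) < 0 <;>
    fin_cases i <;> fin_cases i' <;> simp [h0, h1, h2, h3] at hreg hobs hi ⊢ <;> grind

end Combinatorics

/-! ### The dimension of `H¹(m, n)` -/

section Dimension

/-- The exponents of `x` and `z` determine an obstructed exponent of degree `(m, n)`. -/
def obstructedExponentsEquiv (m n : ℤ) : obstructedExponents m n ≃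
    ↥(Finset.Ioo m 0 ×ˢ Finset.Icc 0 n ∪ Finset.Icc 0 m ×ˢ Finset.Ioo n 0) where
  toFun e := ⟨(e.1 (Sum.inl 0), e.1 (Sum.inr 0)), by
    obtain ⟨e, he⟩ := e
    simp only [obstructedExponents, exponentDegree, Set.mem_ofPred_eq, Fin.forall_fin_two,
      Prod.mk.injEq] at he
    simp only [Finset.mem_union, Finset.mem_product, Finset.mem_Ioo, Finset.mem_Icc]
    omega⟩
  invFun q := ⟨Sum.elim ![q.1.1, m - q.1.1] ![q.1.2, n - q.1.2], by
    obtain ⟨q, hq⟩ := q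
    simp only [Finset.mem_union, Finset.mem_product, Finset.mem_Ioo, Finset.mem_Icc] at hq
    simp only [obstructedExponents, exponentDegree, Set.mem_ofPred_eq, Fin.forall_fin_two,
      Prod.mk.injEq, Sum.elim_inl, Sum.elim_inr, Matrix.cons_val_zero, Matrix.cons_val_one]
    omega⟩
  left_inv e := by
    obtain ⟨e, he⟩ := e
    simp only [obstructedExponents, exponentDegree, Set.mem_ofPred_eq, Prod.mk.injEq] at he
    ext v
    rcases v with v | v <;> fin_cases v <;> simp <;> omega
  right_inv q := by simp

instance (m n : ℤ) : Finite (obstructedExponents m n) :=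
  Finite.of_equiv _ (obstructedExponentsEquiv m n).symm

theorem card_obstructedExponents (m n : ℤ) : Nat.card (obstructedExponents m n)
    = (-m - 1).toNat * (n + 1).toNat + (m + 1).toNat * (-n - 1).toNat := by
  rw [Nat.card_congr (obstructedExponentsEquiv m n), Nat.card_eq_fintype_card, Fintype.card_coe,
    Finset.card_union_of_disjoint]
  · simp [Finset.card_product]
  · rw [Finset.disjoint_left]
    rintro ⟨a, c⟩ h1 h2
    simp only [Finset.mem_product, Finset.mem_Ioo, Finset.mem_Icc] at h1 h2
    omega

variable {k : Type*} [Field k]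

/-- For an obstructed exponent, the indicator function of the component of `farChart e` in the graph
of the pairs of charts on whose intersection the monomial is not regular. -/
def farSide (k : Type*) [Field k] (e : Fin 2 ⊕ Fin 2 → ℤ) (i : Fin 2 × Fin 2) : k :=
  if e (Sum.inl 0) < 0 then (if i.1 = 1 then 1 else 0) else (if i.2 = 1 then 1 else 0)

theorem farSide_farChart (e : Fin 2 ⊕ Fin 2 → ℤ) : farSide k e (farChart e) = 1 := by
  by_cases h : e (Sum.inl 0) < 0 <;> simp [farSide, farChart, h]

theorem farSide_zero (e : Fin 2 ⊕ Fin 2 → ℤ) : farSide k e (0, 0) = 0 := by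
  simp [farSide]

theorem regularExponent_of_farSide_ne {m n : ℤ} {e : Fin 2 ⊕ Fin 2 → ℤ}
    (he : e ∈ obstructedExponents m n) {i j : Fin 2 × Fin 2}
    (h : farSide k e i ≠ farSide k e j) : RegularExponent i j e := by
  obtain ⟨i, i'⟩ := i
  obtain ⟨j, j'⟩ := j
  have key : ∀ a b c : Fin 2, a ≠ b → c = a ∨ c = b := by decide
  rw [regularExponent_iff]
  rcases he.2 with ⟨h1, h2⟩ | ⟨h1, h2⟩
  · refine ⟨fun a _ => key _ _ _ fun hij => h ?_, fun c hc => absurd hc (h2 c).not_gt⟩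
    simp only at hij
    simp [farSide, h1 0, hij]
  · refine ⟨fun a ha => absurd ha (h1 a).not_gt, fun c _ => key _ _ _ fun hij => h ?_⟩
    simp only at hij
    simp [farSide, (h1 0).not_gt, hij]

theorem cocycle_eq_zero {m n : ℤ} {φ : C1 k m n} (hφ : φ ∈ LinearMap.ker (δ1 k m n))
    (i j l : Fin 2 × Fin 2) : (φ j l : K k) - φ i l + φ i j = 0 := by
  rw [LinearMap.mem_ker] at hφ
  have h : (δ1 k m n φ i j l : K k) = 0 := by rw [hφ]; rfl
  exact h

variable (k) in
/-- The obstructed coefficients of a `1`-cocycle: for each obstructed exponent `e`, the coefficient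
of the monomial with exponent `e` in the component that compares `farChart e` to `(0, 0)`. -/
noncomputable def obstruction (m n : ℤ) :
    LinearMap.ker (δ1 k m n) →ₗ[k] (obstructedExponents m n → k) :=
  LinearMap.pi fun e => Finsupp.lapply e.1 ∘ₗ laurentExpansion k ∘ₗ Submodule.subtype _ ∘ₗ
    LinearMap.proj (farChart e.1) ∘ₗ LinearMap.proj (0, 0) ∘ₗ Submodule.subtype _

theorem obstruction_apply {m n : ℤ} (φ : LinearMap.ker (δ1 k m n)) (e : obstructedExponents m n) :
    obstruction k m n φ e = laurentExpansion k (φ.1 (0, 0) (farChart e.1) : K k) e.1 :=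
  rfl

theorem obstruction_surjective (m n : ℤ) : Function.Surjective (obstruction k m n) := by
  intro c
  cases nonempty_fintype (obstructedExponents m n)
  let s : Fin 2 × Fin 2 → Fin 2 × Fin 2 → K k := fun i j =>
    ∑ e : obstructedExponents m n,
      (c e * (farSide k e.1 j - farSide k e.1 i)) • laurentMonomial k e.1
  have hs : ∀ i j, s i j ∈ sections (k := k) m n (cover i ∩ cover j) := by
    intro i j
    refine Submodule.sum_mem _ fun e _ => ?_
    by_cases h : farSide k e.1 i = farSide k e.1 j
    · rw [h, sub_self, mul_zero, zero_smul]
      exact Submodule.zero_mem _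
    · exact Submodule.smul_mem _ _
        (laurentMonomial_mem_sections e.2.1 (regularExponent_of_farSide_ne e.2 h))
  refine ⟨⟨fun i j => ⟨s i j, hs i j⟩, ?_⟩, ?_⟩
  · rw [LinearMap.mem_ker]
    funext i j l
    apply Subtype.ext
    change s j l - s i l + s i j = 0
    rw [← Finset.sum_sub_distrib, ← Finset.sum_add_distrib]
    refine Finset.sum_eq_zero fun e _ => ?_
    rw [← sub_smul, ← add_smul]
    convert zero_smul k _
    ring
  · funext e
    rw [obstruction_apply]
    simp only [s, map_sum, map_smul, laurentExpansion_laurentMonomial, Finsupp.coe_finsetSum,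
      Finset.sum_apply, Finsupp.smul_apply, smul_eq_mul]
    rw [Finset.sum_eq_single_of_mem e (Finset.mem_univ e)]
    · rw [farSide_farChart, farSide_zero, Finsupp.single_eq_same]
      ring
    · intro f _ hf
      rw [Finsupp.single_eq_of_ne fun h => hf (Subtype.ext h.symm), mul_zero]

theorem ker_obstruction [IsAlgClosed k] (m n : ℤ) : LinearMap.ker (obstruction k m n)
    = (LinearMap.range (δ0 k m n)).submoduleOf (LinearMap.ker (δ1 k m n)) := by
  classical
  ext ⟨φ, hφ⟩
  rw [LinearMap.mem_ker, Submodule.submoduleOf, Submodule.mem_comap, LinearMap.mem_range]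
  constructor
  · intro h0
    have hcoc : ∀ e i j l, laurentExpansion k (φ j l : K k) e - laurentExpansion k (φ i l : K k) e
        + laurentExpansion k (φ i j : K k) e = 0 := fun e i j l => by
      simpa using congrArg (fun s => laurentExpansion k s e) (cocycle_eq_zero hφ i j l)
    -- In the exponent `e`, the values of the cocycle on the pairs `(baseChart e, i)`.
    let α : Fin 2 × Fin 2 → (Fin 2 ⊕ Fin 2 → ℤ) →₀ k := fun i =>
      ∑ l, (laurentExpansion k (φ l i : K k)).filter fun e => baseChart e = l
    have hα : ∀ i e, α i e = laurentExpansion k (φ (baseChart e) i : K k) e := fun i e => by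
      simp [α, Finsupp.finsetSum_apply, Finsupp.filter_apply]
    have hmem : ∀ i, Finsupp.linearCombination k (laurentMonomial k) (α i)
        ∈ sections (k := k) m n (cover i) := by
      intro i
      rw [← Set.inter_self (cover i), mem_sections_iff, laurentExpansion_linearCombination]
      refine ⟨rfl, fun e he => ?_⟩
      rw [hα] at he
      have hd := (laurentExpansion_ne_zero_of_mem (φ (baseChart e) i).2 he).1
      refine ⟨hd, ?_⟩
      by_contra hi
      refine he (cocycle_baseChart_eq_zero (m := m) (n := n) (e := e) hd
        (ψ := fun i j => laurentExpansion k (φ i j : K k) e) (hcoc e) ?_ ?_ i hi)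
      · intro i j hij
        by_contra hne
        exact hij (laurentExpansion_ne_zero_of_mem (φ i j).2 hne).2
      · intro he
        exact congrFun h0 ⟨e, he⟩
    refine ⟨fun i => ⟨_, hmem i⟩, ?_⟩
    funext i j
    apply Subtype.ext
    change Finsupp.linearCombination k (laurentMonomial k) (α j)
      - Finsupp.linearCombination k (laurentMonomial k) (α i) = φ i j
    rw [← map_sub, ← (mem_sections_iff.1 (φ i j).2).1]
    congr 1
    ext e
    rw [Finsupp.sub_apply, hα, hα]
    exact (eq_sub_of_cocycle (ψ := fun i j => laurentExpansion k (φ i j : K k) e) (hcoc e)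
      (baseChart e) i j).symm
  · rintro ⟨α, hα⟩
    funext e
    have hzero : ∀ i, laurentExpansion k (α i : K k) e.1 = 0 := by
      intro i
      by_contra hne
      have hmem : (α i : K k) ∈ sections (k := k) m n (cover i ∩ cover i) := by
        rw [Set.inter_self]
        exact (α i).2
      have hreg := (laurentExpansion_ne_zero_of_mem hmem hne).2
      rw [regularExponent_iff] at hreg
      rcases e.2.2 with ⟨h, -⟩ | ⟨-, h⟩
      · have h0 := hreg.1 0 (h 0)
        have h1 := hreg.1 1 (h 1)
        omega
      · have h0 := hreg.2 0 (h 0)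
        have h1 := hreg.2 1 (h 1)
        omega
    have h : (φ (0, 0) (farChart e.1) : K k) = α (farChart e.1) - α (0, 0) := by
      have : δ0 k m n α = φ := hα
      rw [← this]
      rfl
    rw [obstruction_apply, h, map_sub, Finsupp.sub_apply, hzero, hzero, sub_zero]
    rfl

variable (k) in
/-- A class in `H¹(m, n)` is determined by its obstructed coefficients, which are arbitrary. -/
noncomputable def H1Equiv [IsAlgClosed k] (m n : ℤ) :
    H1 k m n ≃ₗ[k] (obstructedExponents m n → k) :=
  (Submodule.quotEquivOfEq _ _ (ker_obstruction m n).symm).trans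
    ((obstruction k m n).quotKerEquivOfSurjective (obstruction_surjective m n))

instance [IsAlgClosed k] (m n : ℤ) : Module.Finite k (H1 k m n) :=
  Module.Finite.equiv (H1Equiv k m n).symm

theorem finrank_H1 [IsAlgClosed k] (m n : ℤ) : Module.finrank k (H1 k m n)
    = (-m - 1).toNat * (n + 1).toNat + (m + 1).toNat * (-n - 1).toNat := by
  cases nonempty_fintype (obstructedExponents m n)
  rw [(H1Equiv k m n).finrank_eq, Module.finrank_fintype_fun_eq_card, ← Nat.card_eq_fintype_card,
    card_obstructedExponents]

theorem subsingleton_H1 [IsAlgClosed k] {m n : ℤ}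
    (h : -1 ≤ m ∧ -1 ≤ n ∨ m ≤ -1 ∧ n ≤ -1) : Subsingleton (H1 k m n) := by
  rw [← Module.finrank_eq_zero_iff_of_free (R := k), finrank_H1]
  rcases h with ⟨h1, h2⟩ | ⟨h1, h2⟩
  · rw [show (-m - 1).toNat = 0 by omega, show (-n - 1).toNat = 0 by omega]; simp
  · rw [show (m + 1).toNat = 0 by omega, show (n + 1).toNat = 0 by omega]; simp

end Dimension

/-! ### The kernel of `d₁` -/

section Kernel

variable {k : Type*} [Field k]

theorem finrank_E2_eq (p : Fin 3 → R k) (hp : ∀ i, p i ∈ gradedPiece k 2 1) {m n : ℤ}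
    (h : Subsingleton (H1 k (m - 4) (n - 2)) ∨ Subsingleton (H1 k (m - 6) (n - 3))) :
    Module.finrank k (E2 p hp m n) = Module.finrank k (H1 k (m - 6) (n - 3)) := by
  have htop : E2 p hp m n = ⊤ := by
    rcases h with h | h
    · exact LinearMap.ker_eq_top.2 (LinearMap.ext fun _ => Subsingleton.elim _ _)
    · exact Subsingleton.elim _ _
  rw [htop, finrank_top]

end Kernel

end BigradedCaseStudy

open BigradedCaseStudy in
theorem proposition3p2 {k : Type*} [Field k] [IsAlgClosed k]
    (p : Fin 3 → R k) (hp : ∀ i, p i ∈ gradedPiece k 2 1)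
    (hzero : ∀ P : P1P1 k, ∃ i, value P (p i) ≠ 0) :
    (∀ m n : ℤ, (5 ≤ m ∧ 2 ≤ n) ∨ (m ≤ 5 ∧ n ≤ 2) → E2 p hp m n = ⊥) ∧
    (∀ m : ℤ, Module.Finite k (E2 p hp m 1) ∧ Module.Finite k (H1 k (m - 6) (-2)) ∧
      Module.finrank k (E2 p hp m 1) = Module.finrank k (H1 k (m - 6) (-2)) ∧
      (Module.finrank k (H1 k (m - 6) (-2)) : ℤ) = if 6 ≤ m then m - 5 else 0) ∧
    (∀ n : ℤ, Module.Finite k (E2 p hp 3 n) ∧ Module.Finite k (H1 k (-3) (n - 3)) ∧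
      Module.finrank k (E2 p hp 3 n) = Module.finrank k (H1 k (-3) (n - 3)) ∧
      (Module.finrank k (H1 k (-3) (n - 3)) : ℤ) = if 3 ≤ n then 2 * (n - 2) else 0) ∧
    (∀ n : ℤ, Module.Finite k (E2 p hp 4 n) ∧ Module.Finite k (H1 k (-2) (n - 3)) ∧
      Module.finrank k (E2 p hp 4 n) = Module.finrank k (H1 k (-2) (n - 3)) ∧
      (Module.finrank k (H1 k (-2) (n - 3)) : ℤ) = if 3 ≤ n then n - 2 else 0) := by
  refine ⟨fun m n h => ?_, fun m => ⟨inferInstance, inferInstance, ?_, ?_⟩,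
    fun n => ⟨inferInstance, inferInstance, ?_, ?_⟩,
    fun n => ⟨inferInstance, inferInstance, ?_, ?_⟩⟩
  · have := subsingleton_H1 (k := k) (m := m - 6) (n := n - 3) (by omega)
    exact Subsingleton.elim _ _
  · have h : Subsingleton (H1 k (m - 4) (1 - 2)) := subsingleton_H1 (by omega)
    exact finrank_E2_eq p hp (Or.inl h)
  · rw [finrank_H1]
    split_ifs <;> simp <;> omega
  · have h : Subsingleton (H1 k (3 - 4) (n - 2)) := subsingleton_H1 (by omega)
    exact finrank_E2_eq p hp (Or.inl h)
  · rw [finrank_H1]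
    split_ifs <;> simp <;> omega
  -- The target of `d₁` vanishes for `n ≥ 1`, its source for `n ≤ 2`.
  · refine finrank_E2_eq p hp (m := 4) ?_
    rcases le_total 1 n with h | h
    · exact Or.inl (subsingleton_H1 (by omega))
    · exact Or.inr (subsingleton_H1 (by omega))
  · rw [finrank_H1]
    split_ifs <;> simp <;> omega
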